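/- Let $n$ be a natural number and let $\{\mu_k\}_{k\in\mathbb{N}}$ be Borel probability measures on $\mathbb{R}^n$ such that every $\mu_k$ is - log-concave: $\mu_k(\lambda A+(1-\lambda)B)\ge \mu_k(A)^\lambda\mu_k(B)^{1-\lambda}$ for all nonempty compact sets $A,B\subseteq\mathbb{R}^n$ and all $\lambda\in(0,1)$; and - isotropic: if $X\sim\mu_k$, then $X$ has finite second moments, $\mathbb{E}X=0$ and $\mathbb{E}XX^T=I_n$. Let $\gamma_n$ be the standard Gaussian distribution on $\mathbb{R}^n$. Then the following are equivalent: 1. $\mu_k\to\gamma_n$ weakly as $k\to\infty$. 2. $\mu_k\to\gamma_n$ in total variation, that is, $d_{TV}(\mu_k,\gamma_n)\to 0$, where $d_{TV}(\mu,\nu)=2\sup_A|\mu(A)-\nu(A)|$, with the supremum over Borel sets $A\subseteq\mathbb{R}^n$. 3. $H(\mu_k\mid\gamma_n)\to 0$, where $H(\mu\mid\nu)=\int\log\left(\frac{d\mu}{d\nu}\right)d\mu\in[0,\infty]$ is the relative entropy, with $H(\mu\mid\nu)=\infty$ if $\mu$ is not absolutely continuous with respect to $\nu$. -/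

import Mathlib

open MeasureTheory ProbabilityTheory Filter
open scoped Topology Pointwise ENNReal

/-- A Borel measure `μ` on `ℝⁿ` is log-concave if
`μ (t A + (1 - t) B) ≥ μ(A) ^ t * μ(B) ^ (1 - t)` for all nonempty compact `A`, `B` and all
`t ∈ (0, 1)`. -/
def IsLogConcaveMeasure {n : ℕ} (μ : Measure (EuclideanSpace ℝ (Fin n))) : Prop :=
  ∀ A B : Set (EuclideanSpace ℝ (Fin n)), A.Nonempty → IsCompact A → B.Nonempty → IsCompact B →
    ∀ t : ℝ, 0 < t → t < 1 → μ A ^ t * μ B ^ (1 - t) ≤ μ (t • A + (1 - t) • B)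

/-- A measure `μ` on `ℝⁿ` is isotropic if, for `X ∼ μ`, the second moments are finite and
`𝔼 X = 0`, `𝔼 X Xᵀ = Iₙ`. -/
structure IsIsotropicMeasure {n : ℕ} (μ : Measure (EuclideanSpace ℝ (Fin n))) : Prop where
  memLp_two : MemLp (fun x : EuclideanSpace ℝ (Fin n) => x) 2 μ
  mean_eq_zero : ∫ x, x ∂μ = 0
  second_moment : (Matrix.of fun i j : Fin n => ∫ x, x i * x j ∂μ) = 1

/-- Total variation distance `2 sup_A |μ(A) - ν(A)|`, the supremum being over measurable sets. -/
noncomputable def tvDistance {Ω : Type*} [MeasurableSpace Ω] (μ ν : ProbabilityMeasure Ω) : ℝ :=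
  2 * ⨆ A : {s : Set Ω // MeasurableSet s},
    |(μ : Measure Ω).real (A : Set Ω) - (ν : Measure Ω).real (A : Set Ω)|

/-- The standard Gaussian distribution `γₙ` on `ℝⁿ`, as an element of the space of probability
measures. -/
noncomputable def standardGaussian (n : ℕ) : ProbabilityMeasure (EuclideanSpace ℝ (Fin n)) :=
  ⟨stdGaussian (EuclideanSpace ℝ (Fin n)), inferInstance⟩

/-!
Convergence in relative entropy implies convergence in total variation by a weak form of Pinsker's
inequality (`abs_measureReal_sub_le_klDiv`), which comes from `(√t - 1) ^ 2 ≤ t * log t + 1 - t`,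
and total variation convergence implies weak convergence by the portmanteau theorem. The main point is
that weak convergence implies convergence in relative entropy.

For this, only upper bounds on the density of `μ k` with respect to the Gaussian measure `γ` are
needed: the relative entropy is the integral of the logarithm of the density against `μ k`, and it
is nonnegative. It suffices that, for large `k`, the density is at most `exp (4ε)` on a given ball,
that the Lebesgue density of `μ k` is bounded on the whole space, and that the second moments of the
`μ k` are uniformly integrable. The last of these follows from the weak convergence and isotropy, as
`∫ ‖x‖ ^ 2 ∂μ k = n = ∫ ‖x‖ ^ 2 ∂γ` (`exists_eventually_setIntegral_compl_closedBall_le`).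

The density bounds follow from log-concavity. Instead of the theorem that a log-concave measure with
full-dimensional support has a log-concave density, the proof uses that for each `δ > 0` the
function `x ↦ μ k (closedBall x δ)` is log-concave (`IsLogConcaveMeasure.closedBall_le`), and proves bounds
that are uniform in small `δ`. Weak convergence controls the masses of fixed balls. From
these masses, convexity of superlevel sets gives a pointwise lower bound
(`IsLogConcaveMeasure.eventually_le_measure_closedBall`). The lower bound, the masses and
log-concavity at midpoints give a pointwise upper bound
(`IsLogConcaveMeasure.measure_closedBall_le`). A Besicovitch covering argument passes to `δ → 0` and
yields absolute continuity together with the bound on the density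
(`measure_le_of_eventually_closedBall_le`).
-/

/-! ### The standard Gaussian measure -/

/-- The density of the standard Gaussian measure on `ℝⁿ`. -/
noncomputable def gaussianDensity (n : ℕ) (x : EuclideanSpace ℝ (Fin n)) : ℝ :=
  (2 * Real.pi) ^ (-(n / 2 : ℝ)) * Real.exp (-‖x‖ ^ 2 / 2)

lemma gaussianDensity_pos {n : ℕ} (x : EuclideanSpace ℝ (Fin n)) : 0 < gaussianDensity n x := by
  unfold gaussianDensity; positivity

lemma continuous_gaussianDensity (n : ℕ) : Continuous (gaussianDensity n) := by
  unfold gaussianDensity; fun_prop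

lemma integral_cexp_inner_mul_gaussianDensity {n : ℕ} (t : EuclideanSpace ℝ (Fin n)) :
    ∫ x, (gaussianDensity n x : ℂ) * Complex.exp (inner ℝ x t * Complex.I) =
      Complex.exp (-‖t‖ ^ 2 / 2) := by
  have h := GaussianFourier.integral_cexp_neg_mul_sq_norm_add (V := EuclideanSpace ℝ (Fin n))
    (b := (1 / 2 : ℂ)) (by norm_num) Complex.I t
  have e : ∀ x : EuclideanSpace ℝ (Fin n),
      (gaussianDensity n x : ℂ) * Complex.exp (inner ℝ x t * Complex.I) =
      (((2 * Real.pi) ^ (-(n / 2 : ℝ)) : ℝ) : ℂ) *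
        Complex.exp (-(1 / 2) * ‖x‖ ^ 2 + Complex.I * inner ℝ t x) := by
    intro x
    rw [gaussianDensity, Complex.ofReal_mul, mul_assoc, Complex.ofReal_exp, ← Complex.exp_add,
      real_inner_comm]
    push_cast
    ring_nf
  simp_rw [e]
  rw [integral_const_mul, h, ← mul_assoc]
  have h2 : ((Real.pi : ℂ) / (1 / 2)) = ((2 * Real.pi : ℝ) : ℂ) := by push_cast; ring
  rw [h2, finrank_euclideanSpace, Fintype.card_fin, Complex.ofReal_cpow (by positivity),
    ← Complex.cpow_add _ _ (by exact_mod_cast (by positivity : (2 * Real.pi : ℝ) ≠ 0))]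
  push_cast
  rw [neg_add_cancel, Complex.cpow_zero, one_mul, Complex.I_sq]
  ring_nf

lemma integrable_gaussianDensity (n : ℕ) : Integrable (gaussianDensity n) := by
  -- Otherwise the Bochner integral would be zero, but its value is the Fourier transform at `0`.
  by_contra h
  have h1 := integral_cexp_inner_mul_gaussianDensity (0 : EuclideanSpace ℝ (Fin n))
  simp only [inner_zero_right, Complex.ofReal_zero, zero_mul, Complex.exp_zero, mul_one,
    norm_zero] at h1
  rw [integral_complex_ofReal, integral_undef h] at h1
  norm_num at h1

/-- The two measures have the same characteristic function. -/
theorem stdGaussian_eq_withDensity (n : ℕ) :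
    stdGaussian (EuclideanSpace ℝ (Fin n)) =
      volume.withDensity fun x => ENNReal.ofReal (gaussianDensity n x) := by
  have : IsFiniteMeasure ((volume : Measure (EuclideanSpace ℝ (Fin n))).withDensity
      fun x => ENNReal.ofReal (gaussianDensity n x)) :=
    isFiniteMeasure_withDensity_ofReal (integrable_gaussianDensity n).2
  refine Measure.ext_of_charFun ?_
  ext t
  rw [charFun_stdGaussian, charFun_apply, integral_withDensity_eq_integral_toReal_smul
    (by have := continuous_gaussianDensity n; fun_prop) (by simp),
    ← integral_cexp_inner_mul_gaussianDensity]
  refine integral_congr_ae (Eventually.of_forall fun x => ?_)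
  simp [ENNReal.toReal_ofReal (gaussianDensity_pos x).le]

lemma absolutelyContinuous_stdGaussian (n : ℕ) :
    (volume : Measure (EuclideanSpace ℝ (Fin n))) ≪ stdGaussian (EuclideanSpace ℝ (Fin n)) := by
  rw [stdGaussian_eq_withDensity]
  refine withDensity_absolutelyContinuous'
    (by have := continuous_gaussianDensity n; fun_prop) (Eventually.of_forall fun x => ?_)
  simpa using gaussianDensity_pos x

lemma memLp_two_stdGaussian (n : ℕ) :
    MemLp (fun x : EuclideanSpace ℝ (Fin n) => x) 2 (stdGaussian (EuclideanSpace ℝ (Fin n))) :=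
  IsGaussian.memLp_two_id

lemma integral_norm_sq_stdGaussian (n : ℕ) :
    ∫ x, ‖x‖ ^ 2 ∂stdGaussian (EuclideanSpace ℝ (Fin n)) = n := by
  have hcoord (i : Fin n) :
      ∫ x, x i ^ 2 ∂stdGaussian (EuclideanSpace ℝ (Fin n)) = 1 := by
    have h := variance_dual_stdGaussian (EuclideanSpace.proj i : EuclideanSpace ℝ (Fin n) →L[ℝ] ℝ)
    rw [variance_of_integral_eq_zero (by fun_prop) (integral_strongDual_stdGaussian _)] at h
    have hn := (EuclideanSpace.basisFun (Fin n) ℝ).norm_dual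
      (EuclideanSpace.proj i : EuclideanSpace ℝ (Fin n) →L[ℝ] ℝ)
    rw [← h] at hn
    simpa [Pi.single_apply] using hn
  simp_rw [EuclideanSpace.real_norm_sq_eq]
  rw [integral_finsetSum]
  · simp [hcoord]
  · intro i _
    exact ((memLp_two_stdGaussian n).continuousLinearMap_comp
      (EuclideanSpace.proj i : EuclideanSpace ℝ (Fin n) →L[ℝ] ℝ)).integrable_sq

lemma IsIsotropicMeasure.integrable_norm_sq {n : ℕ} {μ : Measure (EuclideanSpace ℝ (Fin n))}
    (h : IsIsotropicMeasure μ) : Integrable (fun x => ‖x‖ ^ 2) μ :=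
  h.memLp_two.integrable_norm_pow two_ne_zero

lemma IsIsotropicMeasure.integral_norm_sq {n : ℕ} {μ : Measure (EuclideanSpace ℝ (Fin n))}
    (h : IsIsotropicMeasure μ) : ∫ x, ‖x‖ ^ 2 ∂μ = n := by
  have hcoord (i : Fin n) : ∫ x, x i ^ 2 ∂μ = 1 := by
    simpa [sq] using congrFun (congrFun h.second_moment i) i
  simp_rw [EuclideanSpace.real_norm_sq_eq]
  rw [integral_finsetSum]
  · simp [hcoord]
  · intro i _
    exact (h.memLp_two.continuousLinearMap_comp
      (EuclideanSpace.proj i : EuclideanSpace ℝ (Fin n) →L[ℝ] ℝ)).integrable_sq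

/-! ### Small balls under a log-concave measure -/

open Metric in
/-- A Minkowski combination of two balls of radius `δ` is again a ball of radius `δ`, so
`x ↦ μ (closedBall x δ)` is a log-concave function. Up to normalization it is the density of a
smoothing of `μ`, and it stands in for the density of `μ`, whose existence is not known
beforehand. -/
lemma IsLogConcaveMeasure.closedBall_le {n : ℕ} {μ : Measure (EuclideanSpace ℝ (Fin n))}
    (h : IsLogConcaveMeasure μ) {δ : ℝ} (hδ : 0 ≤ δ) (x y : EuclideanSpace ℝ (Fin n)) {t : ℝ}
    (ht0 : 0 < t) (ht1 : t < 1) :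
    μ (closedBall x δ) ^ t * μ (closedBall y δ) ^ (1 - t) ≤
      μ (closedBall (t • x + (1 - t) • y) δ) := by
  refine (h _ _ (nonempty_closedBall.2 hδ) (isCompact_closedBall x δ) (nonempty_closedBall.2 hδ)
    (isCompact_closedBall y δ) t ht0 ht1).trans (measure_mono ?_)
  rintro _ ⟨_, ⟨a, ha, rfl⟩, _, ⟨b, hb, rfl⟩, rfl⟩
  rw [mem_closedBall, dist_eq_norm] at ha hb ⊢
  calc ‖t • a + (1 - t) • b - (t • x + (1 - t) • y)‖ = ‖t • (a - x) + (1 - t) • (b - y)‖ := by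
        congr 1; module
    _ ≤ t * ‖a - x‖ + (1 - t) * ‖b - y‖ := by
        refine (norm_add_le _ _).trans_eq ?_
        rw [norm_smul, norm_smul, Real.norm_of_nonneg ht0.le, Real.norm_of_nonneg (by linarith)]
    _ ≤ t * δ + (1 - t) * δ := by
        have := sub_pos.2 ht1
        gcongr
    _ = δ := by ring

open Metric in
lemma IsLogConcaveMeasure.convex_setOf_le_closedBall {n : ℕ}
    {μ : Measure (EuclideanSpace ℝ (Fin n))} (h : IsLogConcaveMeasure μ) {δ : ℝ} (hδ : 0 ≤ δ)
    (a : ℝ≥0∞) : Convex ℝ {x | a ≤ μ (closedBall x δ)} := by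
  rw [convex_iff_forall_pos]
  intro x hx y hy t s ht hs hts
  obtain rfl : s = 1 - t := by linarith
  refine le_trans ?_ (h.closedBall_le hδ x y ht (by linarith))
  calc a = a ^ t * a ^ (1 - t) := by
        rw [← ENNReal.rpow_add_of_nonneg _ _ ht.le hs.le, add_sub_cancel, ENNReal.rpow_one]
    _ ≤ _ := mul_le_mul' (ENNReal.rpow_le_rpow hx ht.le) (ENNReal.rpow_le_rpow hy hs.le)

section AverageOverBalls

open Metric

variable {n : ℕ} (μ : Measure (EuclideanSpace ℝ (Fin n)))

/-- Fubini for the set of pairs `(z, w)` with `dist z w ≤ δ`. -/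
lemma lintegral_measure_closedBall [SFinite μ] (p : EuclideanSpace ℝ (Fin n)) (r δ : ℝ) :
    ∫⁻ z in closedBall p r, μ (closedBall z δ) =
      ∫⁻ w, volume (closedBall w δ ∩ closedBall p r) ∂μ := by
  have hm : MeasurableSet {q : EuclideanSpace ℝ (Fin n) × EuclideanSpace ℝ (Fin n) |
      dist q.2 q.1 ≤ δ} := (isClosed_le (by fun_prop) continuous_const).measurableSet
  have h1 := Measure.prod_apply (μ := volume.restrict (closedBall p r)) (ν := μ) hm
  have h2 := Measure.prod_apply_symm (μ := volume.restrict (closedBall p r)) (ν := μ) hm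
  rw [h1] at h2
  refine h2.trans (lintegral_congr fun w => ?_)
  rw [Measure.restrict_apply (measurable_prodMk_right hm)]
  congr 2
  ext z
  simp [dist_comm]

lemma measure_mul_le_lintegral_closedBall [SFinite μ] (p : EuclideanSpace ℝ (Fin n)) (r δ : ℝ) :
    μ (closedBall p (r - δ)) * volume (closedBall (0 : EuclideanSpace ℝ (Fin n)) δ) ≤
      ∫⁻ z in closedBall p r, μ (closedBall z δ) := by
  rw [lintegral_measure_closedBall, mul_comm, ← setLIntegral_const]
  refine le_trans (setLIntegral_mono_ae' measurableSet_closedBall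
    (Eventually.of_forall fun w hw => ?_)) (setLIntegral_le_lintegral (closedBall p (r - δ)) _)
  have hsub : closedBall w δ ⊆ closedBall p r :=
    closedBall_subset_closedBall' (by have := mem_closedBall.1 hw; linarith)
  rw [Set.inter_eq_left.2 hsub, Measure.addHaar_closedBall_center volume w]

lemma lintegral_closedBall_le_measure_mul [SFinite μ] (p : EuclideanSpace ℝ (Fin n)) (r δ : ℝ) :
    ∫⁻ z in closedBall p r, μ (closedBall z δ) ≤
      μ (closedBall p (r + δ)) * volume (closedBall (0 : EuclideanSpace ℝ (Fin n)) δ) := by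
  rw [lintegral_measure_closedBall, mul_comm, ← setLIntegral_const,
    ← lintegral_indicator measurableSet_closedBall]
  refine lintegral_mono fun w => ?_
  by_cases hw : w ∈ closedBall p (r + δ)
  · rw [Set.indicator_of_mem hw, ← Measure.addHaar_closedBall_center volume w]
    exact measure_mono Set.inter_subset_left
  · rw [Set.disjoint_iff_inter_eq_empty.1, measure_empty]
    · exact zero_le
    · refine closedBall_disjoint_closedBall ?_
      rw [mem_closedBall, not_le] at hw
      linarith

variable {μ}

lemma eventually_lt_measure_closedBall_sub [IsFiniteMeasure μ] {p : EuclideanSpace ℝ (Fin n)}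
    {r : ℝ} {c : ℝ≥0∞} (h : c < μ (ball p r)) :
    ∀ᶠ δ in 𝓝[>] 0, c < μ (closedBall p (r - δ)) := by
  obtain ⟨u, hu, hu0, hul⟩ := exists_seq_strictAnti_tendsto (0 : ℝ)
  have hU : ⋃ k, closedBall p (r - u k) = ball p r := by
    ext x
    simp only [Set.mem_iUnion, mem_closedBall, mem_ball]
    constructor
    · rintro ⟨k, hk⟩
      linarith [hu0 k]
    · intro hx
      obtain ⟨k, hk⟩ := (hul.eventually (gt_mem_nhds (sub_pos.2 hx))).exists
      exact ⟨k, by linarith⟩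
  have hmono : Monotone fun k => closedBall p (r - u k) := fun i j hij =>
    closedBall_subset_closedBall (by have := hu.antitone hij; linarith)
  have ht := tendsto_measure_iUnion_atTop (μ := μ) hmono
  rw [hU] at ht
  obtain ⟨k, hk⟩ := (ht.eventually (lt_mem_nhds h)).exists
  filter_upwards [Ioo_mem_nhdsGT (hu0 k)] with δ hδ
  exact hk.trans_le (measure_mono (closedBall_subset_closedBall (by linarith [hδ.2])))

lemma eventually_measure_closedBall_add_lt [IsFiniteMeasure μ] {p : EuclideanSpace ℝ (Fin n)}
    {r : ℝ} {c : ℝ≥0∞} (h : μ (closedBall p r) < c) :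
    ∀ᶠ δ in 𝓝[>] 0, μ (closedBall p (r + δ)) < c := by
  have ht := tendsto_measure_biInter_gt (μ := μ) (s := fun δ : ℝ => closedBall p (r + δ)) (a := 0)
    (fun _ _ => measurableSet_closedBall.nullMeasurableSet)
    (fun i j _ hij => closedBall_subset_closedBall (by linarith)) ⟨1, one_pos, measure_ne_top _ _⟩
  refine ht.eventually (gt_mem_nhds ((measure_mono ?_).trans_lt h))
  intro x hx
  simp only [Set.mem_iInter, mem_closedBall] at hx ⊢
  exact le_of_forall_pos_le_add hx

end AverageOverBalls

section Net

open Metric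

/-- A finite `1/4`-net of the closed unit ball. The ball, not the sphere, is used so that the net is
nonempty in dimension zero too. -/
lemma exists_finite_net (E : Type*) [NormedAddCommGroup E] [NormedSpace ℝ E]
    [FiniteDimensional ℝ E] : ∃ D : Set E, D.Finite ∧ D ⊆ closedBall 0 1 ∧
      ∀ v ∈ closedBall (0 : E) 1, ∃ d ∈ D, ‖v - d‖ ≤ 1 / 4 := by
  have := FiniteDimensional.proper_real E
  obtain ⟨D, hD, hf, hc⟩ := (isCompact_closedBall (0 : E) 1).finite_cover_balls
    (show (0 : ℝ) < 1 / 4 by norm_num)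
  refine ⟨D, hf, hD, fun v hv => ?_⟩
  obtain ⟨d, hd, hvd⟩ := Set.mem_iUnion₂.1 (hc hv)
  exact ⟨d, hd, by rw [← dist_eq_norm]; exact (mem_ball.1 hvd).le⟩

/-- Perturbing each of the points `x₀ + η • d`, for `d` in a `1/4`-net of the unit ball, by at most
`η / 4` leaves the ball of radius `η / 4` around `x₀` inside their convex hull. -/
lemma mem_convexHull_image_net {E : Type*} [NormedAddCommGroup E] [InnerProductSpace ℝ E]
    [FiniteDimensional ℝ E] {D : Set E} (hD : D.Finite)
    (hnet : ∀ v ∈ closedBall (0 : E) 1, ∃ d ∈ D, ‖v - d‖ ≤ 1 / 4) {x₀ : E} {η : ℝ} (hη : 0 < η)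
    {z : E → E} (hz : ∀ d ∈ D, z d ∈ closedBall (x₀ + η • d) (η / 4)) {x : E}
    (hx : x ∈ closedBall x₀ (η / 4)) : x ∈ convexHull ℝ (z '' D) := by
  by_contra hxn
  obtain ⟨f, u, hfu, hux⟩ := geometric_hahn_banach_closed_point (convex_convexHull ℝ _)
    ((hD.image z).isClosed_convexHull ℝ) hxn
  obtain ⟨v, rfl⟩ := (InnerProductSpace.toDual ℝ E).surjective f
  simp only [InnerProductSpace.toDual_apply_apply] at hfu hux
  have hv1 : ‖v‖⁻¹ • v ∈ closedBall (0 : E) 1 := by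
    rw [mem_closedBall_zero_iff, norm_smul, norm_inv, norm_norm]
    exact inv_mul_le_one
  obtain ⟨d, hd, hvd⟩ := hnet _ hv1
  have h1 := hfu _ (subset_convexHull ℝ _ ⟨d, hd, rfl⟩)
  have key (a b : E) (s : ℝ) (hab : ‖a - b‖ ≤ s) : inner ℝ v a ≤ inner ℝ v b + ‖v‖ * s := by
    have : inner ℝ v (a - b) ≤ ‖v‖ * s := (real_inner_le_norm _ _).trans (by gcongr)
    rw [inner_sub_right] at this
    linarith
  have h2 := key x x₀ _ (by simpa [dist_eq_norm] using hx)
  have h3 := key (x₀ + η • d) (z d) (η / 4) (by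
    have := hz d hd
    rwa [mem_closedBall, dist_comm, dist_eq_norm] at this)
  have h4 := key _ _ _ hvd
  have h5 : inner ℝ v (‖v‖⁻¹ • v) = ‖v‖ := by
    rw [inner_smul_right, real_inner_self_eq_norm_sq]
    by_cases h0 : ‖v‖ = 0
    · simp [h0]
    · field_simp
  rw [h5] at h4
  rw [inner_add_right, inner_smul_right] at h3
  have h6 : η * (‖v‖ * (3 / 4)) ≤ η * inner ℝ v d := by gcongr; linarith
  nlinarith [norm_nonneg v, mul_nonneg hη.le (norm_nonneg v)]

end Net

section DensityBounds

open Metric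

variable {n : ℕ} {μ : Measure (EuclideanSpace ℝ (Fin n))} [IsFiniteMeasure μ]

/-- A lower bound `c` for the mean density of `μ` on finitely many balls around `x₀` yields the same
lower bound for the density at all points near `x₀`: each of the balls contains a point where the
density is at least `c`, and superlevel sets of the density are convex. -/
lemma IsLogConcaveMeasure.eventually_le_measure_closedBall (h : IsLogConcaveMeasure μ)
    {D : Set (EuclideanSpace ℝ (Fin n))} (hD : D.Finite)
    (hnet : ∀ v ∈ closedBall (0 : EuclideanSpace ℝ (Fin n)) 1, ∃ d ∈ D, ‖v - d‖ ≤ 1 / 4)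
    {x₀ : EuclideanSpace ℝ (Fin n)} {η : ℝ} (hη : 0 < η) {c : ℝ≥0∞}
    (hc : ∀ d ∈ D, c * volume (closedBall (0 : EuclideanSpace ℝ (Fin n)) (η / 4)) <
      μ (ball (x₀ + η • d) (η / 4))) :
    ∀ᶠ δ in 𝓝[>] 0, ∀ x ∈ closedBall x₀ (η / 4),
      c * volume (closedBall (0 : EuclideanSpace ℝ (Fin n)) δ) ≤ μ (closedBall x δ) := by
  have hev : ∀ᶠ δ in 𝓝[>] 0, ∀ d ∈ D,
      c * volume (closedBall (0 : EuclideanSpace ℝ (Fin n)) (η / 4)) <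
        μ (closedBall (x₀ + η • d) (η / 4 - δ)) :=
    (eventually_all_finite hD).2 fun d hd => eventually_lt_measure_closedBall_sub (hc d hd)
  filter_upwards [hev, self_mem_nhdsWithin] with δ hδ hδ0
  have hV0 : volume (closedBall (0 : EuclideanSpace ℝ (Fin n)) δ) ≠ 0 :=
    (measure_closedBall_pos _ _ hδ0).ne'
  have hVt : volume (closedBall (0 : EuclideanSpace ℝ (Fin n)) δ) ≠ ∞ :=
    measure_closedBall_lt_top.ne
  -- Otherwise the smoothed density is below `c` on a whole ball, against the mass of that ball.
  have hex : ∀ d ∈ D, ∃ z ∈ closedBall (x₀ + η • d) (η / 4),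
      c * volume (closedBall (0 : EuclideanSpace ℝ (Fin n)) δ) ≤ μ (closedBall z δ) := by
    intro d hd
    by_contra! hlt
    have h1 := (measure_mul_le_lintegral_closedBall μ (x₀ + η • d) (η / 4) δ).trans
      (setLIntegral_mono' measurableSet_closedBall fun z hz => (hlt z hz).le)
    rw [setLIntegral_const, Measure.addHaar_closedBall_center volume (x₀ + η • d),
      mul_right_comm] at h1
    exact h1.not_gt (ENNReal.mul_lt_mul_left hV0 hVt (hδ d hd))
  choose! z hz hcz using hex
  intro x hx
  refine convexHull_min ?_ (h.convex_setOf_le_closedBall (le_of_lt hδ0) _)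
    (mem_convexHull_image_net hD hnet hη hz hx)
  rintro _ ⟨d, hd, rfl⟩
  exact hcz d hd

/-- A lower bound for the density of a log-concave measure turns into an upper bound. If the density
`f` is at least `c` on the ball of radius `2r` around `2p - x`, then log-concavity at the midpoint
of `x` and `2w - x` gives `f w ≥ √(c f(x))` for `w` in the ball of radius `r` around `p`, and the mass
of this ball bounds `f x`. Here `f` is the smoothed density at scale `δ`. -/
lemma IsLogConcaveMeasure.measure_closedBall_le (h : IsLogConcaveMeasure μ)
    {x p : EuclideanSpace ℝ (Fin n)} {r δ : ℝ} (hδ : 0 < δ) {c : ℝ≥0∞}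
    (hc : ∀ y ∈ closedBall ((2 : ℝ) • p - x) (2 * r),
      c * volume (closedBall (0 : EuclideanSpace ℝ (Fin n)) δ) ≤ μ (closedBall y δ)) :
    c * μ (closedBall x δ) * volume (closedBall (0 : EuclideanSpace ℝ (Fin n)) r) ^ 2 ≤
      μ (closedBall p (r + δ)) ^ 2 * volume (closedBall (0 : EuclideanSpace ℝ (Fin n)) δ) := by
  have hV0 : volume (closedBall (0 : EuclideanSpace ℝ (Fin n)) δ) ≠ 0 :=
    (measure_closedBall_pos _ _ hδ).ne'
  have hVt : volume (closedBall (0 : EuclideanSpace ℝ (Fin n)) δ) ≠ ∞ :=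
    measure_closedBall_lt_top.ne
  set V := volume (closedBall (0 : EuclideanSpace ℝ (Fin n)) δ)
  set m := μ (closedBall x δ) * (c * V)
  have hle : ∀ w ∈ closedBall p r, m ^ (1 / 2 : ℝ) ≤ μ (closedBall w δ) := by
    intro w hw
    have hy : (2 : ℝ) • w - x ∈ closedBall ((2 : ℝ) • p - x) (2 * r) := by
      rw [mem_closedBall, dist_eq_norm] at hw ⊢
      rw [sub_sub_sub_cancel_right, ← smul_sub, norm_smul, Real.norm_ofNat]
      gcongr
    have h1 := h.closedBall_le hδ.le x ((2 : ℝ) • w - x) (t := 1 / 2) (by norm_num) (by norm_num)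
    have h2 : (1 / 2 : ℝ) • x + (1 - 1 / 2 : ℝ) • ((2 : ℝ) • w - x) = w := by module
    rw [h2, show (1 - 1 / 2 : ℝ) = 1 / 2 by norm_num] at h1
    refine le_trans ?_ h1
    rw [← ENNReal.mul_rpow_of_nonneg _ _ (by norm_num)]
    exact ENNReal.rpow_le_rpow (mul_le_mul_right (hc _ hy) _) (by norm_num)
  have h3 := (setLIntegral_mono' measurableSet_closedBall hle).trans
    (lintegral_closedBall_le_measure_mul μ p r δ)
  rw [setLIntegral_const, Measure.addHaar_closedBall_center volume p] at h3
  have h4 := pow_le_pow_left' h3 2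
  rw [mul_pow, mul_pow, ← ENNReal.rpow_natCast (m ^ _), ← ENNReal.rpow_mul] at h4
  norm_num at h4
  rw [← ENNReal.mul_le_mul_iff_left hV0 hVt]
  calc _ = m * volume (closedBall (0 : EuclideanSpace ℝ (Fin n)) r) ^ 2 := by simp only [m]; ring
    _ ≤ _ := h4
    _ = _ := by ring

/-- Differentiation of measures, in the form of a Besicovitch covering argument. -/
lemma measure_le_of_eventually_closedBall_le {s : Set (EuclideanSpace ℝ (Fin n))} {C : ℝ≥0∞}
    (hC : C ≠ ∞) (h : ∀ x ∈ s, ∀ᶠ δ in 𝓝[>] 0,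
      μ (closedBall x δ) ≤ C * volume (closedBall (0 : EuclideanSpace ℝ (Fin n)) δ)) :
    μ s ≤ C * volume s := by
  lift C to NNReal using hC
  have := (Besicovitch.vitaliFamily μ).measure_le_of_frequently_le (C • volume)
    (Measure.AbsolutelyContinuous.refl μ) s fun x hx => ?_
  · simpa using this
  · refine (Besicovitch.tendsto_filterAt μ x).frequently (Eventually.frequently ?_)
    filter_upwards [h x hx] with δ hδ
    simpa [Measure.addHaar_closedBall_center volume x] using hδ

end DensityBounds

/-! ### Density bounds along a weakly convergent sequence -/

section GaussianBounds

variable {n : ℕ} {s : Set (EuclideanSpace ℝ (Fin n))} {c : ℝ}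

lemma mul_volume_le_stdGaussian (hs : MeasurableSet s) (h : ∀ x ∈ s, c ≤ gaussianDensity n x) :
    ENNReal.ofReal c * volume s ≤ stdGaussian (EuclideanSpace ℝ (Fin n)) s := by
  rw [stdGaussian_eq_withDensity, withDensity_apply _ hs, ← setLIntegral_const]
  exact setLIntegral_mono' hs fun x hx => ENNReal.ofReal_le_ofReal (h x hx)

lemma stdGaussian_le_mul_volume (hs : MeasurableSet s) (h : ∀ x ∈ s, gaussianDensity n x ≤ c) :
    stdGaussian (EuclideanSpace ℝ (Fin n)) s ≤ ENNReal.ofReal c * volume s := by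
  rw [stdGaussian_eq_withDensity, withDensity_apply _ hs, ← setLIntegral_const]
  exact setLIntegral_mono' hs fun x hx => ENNReal.ofReal_le_ofReal (h x hx)

end GaussianBounds

section WeakLimit

open Metric

variable {n : ℕ} {μ : ℕ → ProbabilityMeasure (EuclideanSpace ℝ (Fin n))}

lemma exists_closedBall_forall_lt {E : Type*} [PseudoMetricSpace E] {f : E → ℝ}
    (hf : Continuous f) {x₀ : E} {a b : ℝ} (ha : a < f x₀) (hb : f x₀ < b) :
    ∃ r > 0, ∀ x ∈ closedBall x₀ r, a < f x ∧ f x < b :=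
  nhds_basis_closedBall.eventually_iff.1
    (hf.continuousAt.eventually ((lt_mem_nhds ha).and (gt_mem_nhds hb)))

/-- Along a weakly convergent sequence, the densities are eventually bounded below, near `x₀`, by
any constant smaller than the Gaussian density at `x₀`. -/
lemma eventually_le_measure_closedBall_of_tendsto
    (hlc : ∀ k, IsLogConcaveMeasure (μ k : Measure (EuclideanSpace ℝ (Fin n))))
    (hμ : Tendsto μ atTop (𝓝 (standardGaussian n))) (x₀ : EuclideanSpace ℝ (Fin n)) {c : ℝ}
    (hc0 : 0 < c) (hc : c < gaussianDensity n x₀) :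
    ∃ ρ > 0, ∀ᶠ k in atTop, ∀ᶠ δ in 𝓝[>] 0, ∀ x ∈ closedBall x₀ ρ,
      ENNReal.ofReal c * volume (closedBall (0 : EuclideanSpace ℝ (Fin n)) δ) ≤
        (μ k : Measure (EuclideanSpace ℝ (Fin n))) (closedBall x δ) := by
  obtain ⟨c', hcc', hc'⟩ := exists_between hc
  obtain ⟨r, hr, hφ⟩ := exists_closedBall_forall_lt (continuous_gaussianDensity n) hc'
    (lt_add_one (gaussianDensity n x₀))
  obtain ⟨D, hD, hD1, hnet⟩ := exists_finite_net (EuclideanSpace ℝ (Fin n))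
  have hη : 0 < r / 2 := by positivity
  refine ⟨r / 2 / 4, by positivity, ?_⟩
  have hev : ∀ᶠ k in atTop, ∀ d ∈ D,
      ENNReal.ofReal c * volume (closedBall (0 : EuclideanSpace ℝ (Fin n)) (r / 2 / 4)) <
        (μ k : Measure (EuclideanSpace ℝ (Fin n))) (ball (x₀ + (r / 2) • d) (r / 2 / 4)) := by
    refine (eventually_all_finite hD).2 fun d hd => ?_
    refine eventually_lt_of_lt_liminf (lt_of_lt_of_le ?_
      (ProbabilityMeasure.le_liminf_measure_open_of_tendsto hμ isOpen_ball))
    refine lt_of_lt_of_le ?_ (mul_volume_le_stdGaussian (c := c') measurableSet_ball fun x hx =>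
      (hφ x ?_).1.le)
    · rw [Measure.addHaar_closedBall volume _ (by positivity),
        ← Measure.addHaar_ball_of_pos volume (x₀ + (r / 2) • d) (by positivity)]
      refine ENNReal.mul_lt_mul_left (measure_ball_pos _ _ (by positivity)).ne'
        measure_ball_lt_top.ne ?_
      exact (ENNReal.ofReal_lt_ofReal_iff (hc0.trans hcc')).2 hcc'
    · have hd1 : ‖d‖ ≤ 1 := by simpa using hD1 hd
      refine (ball_subset_closedBall.trans (closedBall_subset_closedBall' ?_)) hx
      rw [dist_eq_norm, add_sub_cancel_left, norm_smul, Real.norm_of_nonneg hη.le]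
      nlinarith
  filter_upwards [hev] with k hk
  exact (hlc k).eventually_le_measure_closedBall hD hnet hη hk

/-- The densities are eventually bounded, uniformly on the whole space. -/
lemma eventually_measure_le_mul_volume
    (hlc : ∀ k, IsLogConcaveMeasure (μ k : Measure (EuclideanSpace ℝ (Fin n))))
    (hμ : Tendsto μ atTop (𝓝 (standardGaussian n))) :
    ∃ C : ℝ, 0 < C ∧ ∀ᶠ k in atTop, ∀ s,
      (μ k : Measure (EuclideanSpace ℝ (Fin n))) s ≤ ENNReal.ofReal C * volume s := by
  have hφ := gaussianDensity_pos (0 : EuclideanSpace ℝ (Fin n))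
  obtain ⟨ρ, hρ, hev⟩ := eventually_le_measure_closedBall_of_tendsto hlc hμ 0 (half_pos hφ)
    (half_lt_self hφ)
  set c := gaussianDensity n 0 / 2
  have hc : 0 < c := half_pos hφ
  set V := volume (closedBall (0 : EuclideanSpace ℝ (Fin n)) (ρ / 2))
  have hV0 : V ≠ 0 := (measure_closedBall_pos _ _ (by positivity)).ne'
  have hVt : V ≠ ∞ := measure_closedBall_lt_top.ne
  have hVr : 0 < V.toReal := ENNReal.toReal_pos hV0 hVt
  have hVe : V = ENNReal.ofReal V.toReal := (ENNReal.ofReal_toReal hVt).symm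
  refine ⟨(c * V.toReal ^ 2)⁻¹, by positivity, ?_⟩
  filter_upwards [hev] with k hk s
  refine measure_le_of_eventually_closedBall_le ENNReal.ofReal_ne_top fun x _ => ?_
  filter_upwards [hk, self_mem_nhdsWithin] with δ hδ hδ0
  -- The midpoint `p = x / 2` makes the ball around `2p - x` the fixed ball around the origin.
  have h := (hlc k).measure_closedBall_le (x := x) (p := (1 / 2 : ℝ) • x) (r := ρ / 2) hδ0
    (c := ENNReal.ofReal c) (fun y hy => hδ y (by
      rwa [smul_smul, show (2 : ℝ) * (1 / 2) = 1 by norm_num, one_smul, sub_self,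
        show 2 * (ρ / 2) = ρ by ring] at hy))
  have h1 : (μ k : Measure (EuclideanSpace ℝ (Fin n)))
      (closedBall ((1 / 2 : ℝ) • x) (ρ / 2 + δ)) ^ 2 ≤ 1 := pow_le_one' prob_le_one 2
  rw [ENNReal.ofReal_inv_of_pos (by positivity), ENNReal.ofReal_mul hc.le,
    ENNReal.ofReal_pow hVr.le, ← hVe, mul_comm, ← div_eq_mul_inv, ENNReal.le_div_iff_mul_le]
  · calc _ = _ := by rw [← mul_assoc, mul_comm (_ : ℝ≥0∞) (ENNReal.ofReal c)]
      _ ≤ _ := h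
      _ ≤ 1 * _ := by gcongr
      _ = _ := one_mul _
  · exact Or.inl (mul_ne_zero (ENNReal.ofReal_pos.2 hc).ne' (pow_ne_zero 2 hV0))
  · exact Or.inl (ENNReal.mul_ne_top ENNReal.ofReal_ne_top (ENNReal.pow_ne_top hVt))

/-- Local upper bound with a constant arbitrarily close to one. The density is at least `φ / b` near
`x₀`, where `φ` is the Gaussian density at `x₀`, and has mean at most `φ * b` on a small ball; by
`IsLogConcaveMeasure.measure_closedBall_le` it is at most `(φ * b) ^ 2 / (φ / b) = φ * b ^ 3`. -/
lemma eventually_measure_le_mul_stdGaussian_near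
    (hlc : ∀ k, IsLogConcaveMeasure (μ k : Measure (EuclideanSpace ℝ (Fin n))))
    (hμ : Tendsto μ atTop (𝓝 (standardGaussian n))) (x₀ : EuclideanSpace ℝ (Fin n)) {b : ℝ}
    (hb : 1 < b) :
    ∃ ρ > 0, ∀ᶠ k in atTop, ∀ s ⊆ ball x₀ ρ, MeasurableSet s →
      (μ k : Measure (EuclideanSpace ℝ (Fin n))) s ≤
        ENNReal.ofReal (b ^ 4) * stdGaussian (EuclideanSpace ℝ (Fin n)) s := by
  have hφ := gaussianDensity_pos x₀
  set φ := gaussianDensity n x₀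
  have hb0 : 0 < b := one_pos.trans hb
  have hφb : φ / b < φ := div_lt_self hφ hb
  have hbφ : φ < φ * b := lt_mul_of_one_lt_right hφ hb
  obtain ⟨ρ₁, hρ₁, hev⟩ := eventually_le_measure_closedBall_of_tendsto hlc hμ x₀
    (by positivity : 0 < φ / b) hφb
  obtain ⟨c₂, hc₂, hc₂b⟩ := exists_between hbφ
  obtain ⟨ρ₂, hρ₂, hφr⟩ := exists_closedBall_forall_lt (continuous_gaussianDensity n)
    hφb hc₂
  obtain ⟨ρ, hρ, hρ₁', hρ₂'⟩ : ∃ ρ > 0, 2 * ρ + ρ ≤ ρ₁ ∧ ρ ≤ ρ₂ :=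
    ⟨min (ρ₁ / 3) ρ₂, by positivity, by linarith [min_le_left (ρ₁ / 3) ρ₂], min_le_right _ _⟩
  set V := volume (closedBall (0 : EuclideanSpace ℝ (Fin n)) ρ)
  have hV0 : V ≠ 0 := (measure_closedBall_pos _ _ hρ).ne'
  have hVt : V ≠ ∞ := measure_closedBall_lt_top.ne
  have hup : ∀ᶠ k in atTop, (μ k : Measure (EuclideanSpace ℝ (Fin n))) (closedBall x₀ ρ) <
      ENNReal.ofReal (φ * b) * V := by
    refine eventually_lt_of_limsup_lt (lt_of_le_of_lt
      (ProbabilityMeasure.limsup_measure_closed_le_of_tendsto hμ isClosed_closedBall) ?_)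
    refine lt_of_le_of_lt (stdGaussian_le_mul_volume (c := c₂) measurableSet_closedBall fun x hx =>
      (hφr x (closedBall_subset_closedBall hρ₂' hx)).2.le) ?_
    rw [Measure.addHaar_closedBall_center volume x₀]
    exact ENNReal.mul_lt_mul_left hV0 hVt
      ((ENNReal.ofReal_lt_ofReal_iff (by positivity)).2 hc₂b)
  refine ⟨ρ, hρ, ?_⟩
  filter_upwards [hev, hup] with k hk hkup s hs hsm
  have hvol : (μ k : Measure (EuclideanSpace ℝ (Fin n))) s ≤
      ENNReal.ofReal (φ * b ^ 3) * volume s := by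
    refine measure_le_of_eventually_closedBall_le ENNReal.ofReal_ne_top fun x hx => ?_
    filter_upwards [hk, eventually_measure_closedBall_add_lt hkup, self_mem_nhdsWithin] with
      δ hδ hδup hδ0
    have h := (hlc k).measure_closedBall_le (x := x) (p := x₀) (r := ρ) hδ0
      (c := ENNReal.ofReal (φ / b)) (fun y hy => hδ y (by
        refine closedBall_subset_closedBall' ?_ hy
        have hxs := mem_ball.1 (hs hx)
        rw [dist_comm, dist_eq_norm] at hxs
        rw [dist_eq_norm, show (2 : ℝ) • x₀ - x - x₀ = x₀ - x by module]
        linarith))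
    have h2 := h.trans (mul_le_mul_left (pow_le_pow_left' hδup.le 2) _)
    rw [mul_pow, mul_right_comm _ (V ^ 2),
      ENNReal.mul_le_mul_iff_left (pow_ne_zero 2 hV0) (ENNReal.pow_ne_top hVt)] at h2
    rw [← ENNReal.mul_le_mul_iff_right (a := ENNReal.ofReal (φ / b))
      (ENNReal.ofReal_pos.2 (by positivity)).ne' ENNReal.ofReal_ne_top]
    refine h2.trans_eq ?_
    rw [← mul_assoc, ← ENNReal.ofReal_pow (by positivity), ← ENNReal.ofReal_mul (by positivity)]
    congr 2
    field_simp
  refine hvol.trans ?_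
  calc ENNReal.ofReal (φ * b ^ 3) * volume s
      = ENNReal.ofReal (b ^ 4) * (ENNReal.ofReal (φ / b) * volume s) := by
        rw [← mul_assoc, ← ENNReal.ofReal_mul (by positivity)]
        congr 2
        field_simp
    _ ≤ _ := by
        gcongr
        exact mul_volume_le_stdGaussian hsm fun x hx =>
          (hφr x (closedBall_subset_closedBall hρ₂' (ball_subset_closedBall (hs hx)))).1.le

end WeakLimit

/-! ### Relative entropy and total variation -/

section Entropy

open InformationTheory

variable {Ω : Type*} [MeasurableSpace Ω] {μ ν : Measure Ω}

lemma rnDeriv_le_of_forall_measure_le [SigmaFinite μ] [SigmaFinite ν] (hμν : μ ≪ ν) {B : Set Ω}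
    (hB : MeasurableSet B) {g : Ω → ℝ≥0∞}
    (h : ∀ s ⊆ B, MeasurableSet s → μ s ≤ ∫⁻ x in s, g x ∂ν) :
    ∀ᵐ x ∂ν, x ∈ B → μ.rnDeriv ν x ≤ g x := by
  rw [← ae_restrict_iff' hB]
  refine ae_le_of_forall_setLIntegral_le_of_sigmaFinite (Measure.measurable_rnDeriv _ _)
    fun s hs _ => ?_
  rw [Measure.restrict_restrict hs, Measure.setLIntegral_rnDeriv hμν]
  exact h _ Set.inter_subset_right (hs.inter hB)

/-- Only an upper bound on the density is needed to bound the relative entropy: the negative part of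
the log-likelihood ratio is integrable because `t * log t` is bounded below. -/
lemma klDiv_le_ofReal_integral [IsProbabilityMeasure μ] [IsProbabilityMeasure ν] (hμν : μ ≪ ν)
    {g : Ω → ℝ} (hg : Integrable g μ)
    (h : ∀ᵐ x ∂ν, μ.rnDeriv ν x ≤ ENNReal.ofReal (Real.exp (g x))) :
    klDiv μ ν ≤ ENNReal.ofReal (∫ x, g x ∂μ) := by
  have hle : ∀ᵐ x ∂ν, (μ.rnDeriv ν x).toReal * Real.log (μ.rnDeriv ν x).toReal ≤
      (μ.rnDeriv ν x).toReal * g x := by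
    filter_upwards [h] with x hx
    rcases (ENNReal.toReal_nonneg (a := μ.rnDeriv ν x)).eq_or_lt with h0 | h0
    · simp [← h0]
    · refine mul_le_mul_of_nonneg_left ((Real.log_le_iff_le_exp h0).2 ?_) h0.le
      exact ENNReal.toReal_le_of_le_ofReal (Real.exp_pos _).le hx
  have hgν : Integrable (fun x => (μ.rnDeriv ν x).toReal * g x) ν :=
    (integrable_toReal_rnDeriv_mul_iff hμν).2 hg
  have hint : Integrable (llr μ ν) μ := by
    rw [← integrable_rnDeriv_mul_log_iff hμν]
    refine Integrable.mono' (hgν.norm.add (integrable_const 1)) (by fun_prop) ?_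
    filter_upwards [hle] with x hx
    have hkl := klFun_nonneg (ENNReal.toReal_nonneg (a := μ.rnDeriv ν x))
    rw [klFun_apply] at hkl
    rw [Real.norm_eq_abs, abs_le]
    simp only [Pi.add_apply, Real.norm_eq_abs]
    have h1 := le_abs_self ((μ.rnDeriv ν x).toReal * g x)
    have h2 := abs_nonneg ((μ.rnDeriv ν x).toReal * g x)
    have h3 := ENNReal.toReal_nonneg (a := μ.rnDeriv ν x)
    constructor <;> linarith
  rw [klDiv_of_ac_of_integrable hμν hint]
  refine ENNReal.ofReal_le_ofReal ?_
  simp only [probReal_univ, add_sub_cancel_right]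
  rw [← integral_rnDeriv_mul_log hμν, ← integral_toReal_rnDeriv_mul hμν (f := g)]
  exact integral_mono_ae ((integrable_rnDeriv_mul_log_iff hμν).2 hint) hgν hle

lemma sq_sqrt_sub_one_le_klFun {x : ℝ} (hx : 0 ≤ x) : (√x - 1) ^ 2 ≤ klFun x := by
  rcases hx.eq_or_lt with rfl | hx0
  · simp [klFun_zero]
  have hs : 0 < √x := Real.sqrt_pos.2 hx0
  have h1 := Real.one_sub_inv_le_log_of_pos hs
  have h2 : Real.log x = 2 * Real.log √x := by rw [Real.log_sqrt hx]; ring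
  have h3 : x * (1 - (√x)⁻¹) ≤ x * Real.log √x := mul_le_mul_of_nonneg_left h1 hx
  have h4 : x * (√x)⁻¹ = √x := by rw [← div_eq_mul_inv, Real.div_sqrt]
  rw [klFun_apply, h2]
  nlinarith [Real.sq_sqrt hx]

lemma abs_sub_one_le_klFun {x η : ℝ} (hx : 0 ≤ x) (hη : 0 < η) :
    |x - 1| ≤ η + (η⁻¹ + 1) * klFun x := by
  have h1 := sq_sqrt_sub_one_le_klFun hx
  set u := |√x - 1|
  have hu : 0 ≤ u := abs_nonneg _
  have h2 : |x - 1| ≤ u * (u + 2) := by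
    have : x - 1 = (√x - 1) * (√x + 1) := by nlinarith [Real.sq_sqrt hx]
    rw [this, abs_mul, abs_of_nonneg (by positivity : 0 ≤ √x + 1)]
    have := le_abs_self (√x - 1)
    exact mul_le_mul_of_nonneg_left (by linarith) hu
  have h3 : 2 * u ≤ η + η⁻¹ * u ^ 2 := by
    have : 0 ≤ η⁻¹ * (u - η) ^ 2 := by positivity
    have h5 : η⁻¹ * (u - η) ^ 2 = η⁻¹ * u ^ 2 - 2 * u + η := by field_simp; ring
    linarith
  have h4 : u ^ 2 ≤ klFun x := by rwa [sq_abs]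
  calc |x - 1| ≤ η + (η⁻¹ + 1) * u ^ 2 := by nlinarith
    _ ≤ _ := by gcongr

/-- A weak form of Pinsker's inequality: with `η` the square root of the relative entropy it has the
same order. -/
lemma abs_measureReal_sub_le_klDiv [IsProbabilityMeasure μ] [IsProbabilityMeasure ν]
    (h : klDiv μ ν ≠ ∞) {η : ℝ} (hη : 0 < η) (A : Set Ω) :
    |μ.real A - ν.real A| ≤ η + (η⁻¹ + 1) * (klDiv μ ν).toReal := by
  obtain ⟨hμν, hint⟩ := klDiv_ne_top_iff.1 h
  have hf : Integrable (fun x => (μ.rnDeriv ν x).toReal - 1) ν :=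
    Measure.integrable_toReal_rnDeriv.sub (integrable_const 1)
  have hk := (integrable_klFun_rnDeriv_iff hμν).2 hint
  have h1 : μ.real A - ν.real A = ∫ x in A, ((μ.rnDeriv ν x).toReal - 1) ∂ν := by
    rw [integral_sub Measure.integrable_toReal_rnDeriv.integrableOn (integrable_const 1),
      Measure.setIntegral_toReal_rnDeriv hμν]
    simp
  rw [h1, toReal_klDiv_eq_integral_klFun hμν]
  calc |∫ x in A, ((μ.rnDeriv ν x).toReal - 1) ∂ν|
      ≤ ∫ x in A, |(μ.rnDeriv ν x).toReal - 1| ∂ν := abs_integral_le_integral_abs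
    _ ≤ ∫ x, |(μ.rnDeriv ν x).toReal - 1| ∂ν :=
        setIntegral_le_integral hf.abs (Eventually.of_forall fun _ => abs_nonneg _)
    _ ≤ ∫ x, (η + (η⁻¹ + 1) * klFun (μ.rnDeriv ν x).toReal) ∂ν :=
        integral_mono hf.abs ((integrable_const _).add (hk.const_mul _))
          fun x => abs_sub_one_le_klFun ENNReal.toReal_nonneg hη
    _ = _ := by
        rw [integral_add (integrable_const _) (hk.const_mul _), integral_const_mul]
        simp

end Entropy

section TotalVariation

variable {Ω : Type*} [MeasurableSpace Ω] {μ ν : ProbabilityMeasure Ω}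

lemma tvDistance_nonneg (μ ν : ProbabilityMeasure Ω) : 0 ≤ tvDistance μ ν :=
  mul_nonneg zero_le_two (Real.iSup_nonneg fun _ => abs_nonneg _)

lemma tvDistance_le {C : ℝ} (h : ∀ A, MeasurableSet A →
    |(μ : Measure Ω).real A - (ν : Measure Ω).real A| ≤ C) : tvDistance μ ν ≤ 2 * C := by
  have : Nonempty {s : Set Ω // MeasurableSet s} := ⟨⟨∅, .empty⟩⟩
  exact mul_le_mul_of_nonneg_left (ciSup_le fun A => h A A.2) zero_le_two

lemma abs_measureReal_sub_le_tvDistance {A : Set Ω} (hA : MeasurableSet A) :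
    |(μ : Measure Ω).real A - (ν : Measure Ω).real A| ≤ tvDistance μ ν / 2 := by
  rw [tvDistance, mul_div_cancel_left₀ _ two_ne_zero]
  refine le_ciSup (f := fun A : {s : Set Ω // MeasurableSet s} =>
    |(μ : Measure Ω).real A - (ν : Measure Ω).real A|) ⟨1, ?_⟩ ⟨A, hA⟩
  rintro _ ⟨B, rfl⟩
  have h1 := measureReal_le_one (μ := (μ : Measure Ω)) (s := B)
  have h2 := measureReal_le_one (μ := (ν : Measure Ω)) (s := B)
  have h3 := measureReal_nonneg (μ := (μ : Measure Ω)) (s := B)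
  have h4 := measureReal_nonneg (μ := (ν : Measure Ω)) (s := B)
  rw [abs_le]
  constructor <;> linarith

lemma tendsto_of_tendsto_tvDistance [PseudoEMetricSpace Ω] [BorelSpace Ω]
    {μ : ℕ → ProbabilityMeasure Ω}
    (h : Tendsto (fun k => tvDistance (μ k) ν) atTop (𝓝 0)) : Tendsto μ atTop (𝓝 ν) := by
  refine tendsto_of_forall_isOpen_le_liminf' fun G hG => ?_
  have h1 : Tendsto (fun k => (μ k : Measure Ω).real G) atTop (𝓝 ((ν : Measure Ω).real G)) := by
    rw [tendsto_iff_dist_tendsto_zero]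
    refine squeeze_zero (fun _ => dist_nonneg) (fun k => ?_) (by simpa using h.div_const 2)
    exact abs_measureReal_sub_le_tvDistance hG.measurableSet
  refine (Tendsto.liminf_eq ?_).ge
  simpa [measureReal_def] using ENNReal.tendsto_ofReal h1

lemma tendsto_tvDistance_of_tendsto_klDiv {μ : ℕ → ProbabilityMeasure Ω}
    (h : Tendsto (fun k => InformationTheory.klDiv (μ k : Measure Ω) (ν : Measure Ω)) atTop
      (𝓝 0)) : Tendsto (fun k => tvDistance (μ k) ν) atTop (𝓝 0) := by
  have hfin : ∀ᶠ k in atTop, InformationTheory.klDiv (μ k : Measure Ω) (ν : Measure Ω) ≠ ∞ :=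
    (h.eventually (gt_mem_nhds ENNReal.zero_lt_top)).mono fun _ => ne_of_lt
  have hreal : Tendsto (fun k => (InformationTheory.klDiv (μ k : Measure Ω) (ν : Measure Ω)).toReal)
      atTop (𝓝 0) := (ENNReal.tendsto_toReal ENNReal.zero_ne_top).comp h
  refine tendsto_order.2 ⟨fun a ha => Eventually.of_forall fun k =>
    ha.trans_le (tvDistance_nonneg _ _), fun ε hε => ?_⟩
  have hlim : Tendsto (fun k => 2 * (ε / 4 + ((ε / 4)⁻¹ + 1) *
      (InformationTheory.klDiv (μ k : Measure Ω) (ν : Measure Ω)).toReal)) atTop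
      (𝓝 (2 * (ε / 4 + ((ε / 4)⁻¹ + 1) * 0))) :=
    ((hreal.const_mul _).const_add _).const_mul _
  filter_upwards [hfin, hlim.eventually (gt_mem_nhds (show _ < ε by linarith))] with k hk hkε
  exact (tvDistance_le fun A _ => abs_measureReal_sub_le_klDiv hk (by positivity) A).trans_lt hkε

end TotalVariation

/-! ### Weak convergence implies convergence in relative entropy -/

section Tail

variable {n : ℕ} {μ : ℕ → ProbabilityMeasure (EuclideanSpace ℝ (Fin n))}

lemma integrable_min_norm_sq (ν : Measure (EuclideanSpace ℝ (Fin n))) [IsFiniteMeasure ν]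
    {T : ℝ} (hT : 0 ≤ T) : Integrable (fun x => min (‖x‖ ^ 2) T) ν := by
  refine Integrable.of_bound (by fun_prop) T (Eventually.of_forall fun x => ?_)
  rw [Real.norm_of_nonneg (by positivity)]
  exact min_le_right _ _

lemma tendsto_integral_min_norm_sq :
    Tendsto (fun T : ℕ => ∫ x, min (‖x‖ ^ 2) (T : ℝ) ∂stdGaussian (EuclideanSpace ℝ (Fin n)))
      atTop (𝓝 n) := by
  rw [← integral_norm_sq_stdGaussian n]
  refine tendsto_integral_of_dominated_convergence (fun x => ‖x‖ ^ 2) (fun _ => by fun_prop)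
    ((memLp_two_stdGaussian n).integrable_norm_pow two_ne_zero)
    (fun T => Eventually.of_forall fun x => ?_) (Eventually.of_forall fun x => ?_)
  · rw [Real.norm_of_nonneg (by positivity)]
    exact min_le_left _ _
  · refine tendsto_const_nhds.congr' ?_
    filter_upwards [eventually_ge_atTop ⌈‖x‖ ^ 2⌉₊] with T hT
    exact (min_eq_left (Nat.ceil_le.1 hT)).symm

lemma tendsto_integral_min_norm_sq_of_tendsto (hμ : Tendsto μ atTop (𝓝 (standardGaussian n)))
    {T : ℝ} (hT : 0 ≤ T) :
    Tendsto (fun k => ∫ x, min (‖x‖ ^ 2) T ∂(μ k : Measure (EuclideanSpace ℝ (Fin n)))) atTop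
      (𝓝 (∫ x, min (‖x‖ ^ 2) T ∂stdGaussian (EuclideanSpace ℝ (Fin n)))) :=
  ProbabilityMeasure.tendsto_iff_forall_integral_tendsto.1 hμ
    (BoundedContinuousFunction.ofNormedAddCommGroup (fun x => min (‖x‖ ^ 2) T) (by fun_prop) T
      fun x => by
        rw [Real.norm_of_nonneg (by positivity)]
        exact min_le_right _ _)

/-- The second moments are uniformly integrable: they all equal `n`, the second moment of the
Gaussian limit, so no second moment escapes to infinity. -/
lemma exists_eventually_setIntegral_compl_closedBall_le
    (hiso : ∀ k, IsIsotropicMeasure (μ k : Measure (EuclideanSpace ℝ (Fin n))))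
    (hμ : Tendsto μ atTop (𝓝 (standardGaussian n))) {c ε : ℝ} (hc : 0 ≤ c) (hε : 0 < ε) :
    ∃ R : ℝ, ∀ᶠ k in atTop, ∫ x in (Metric.closedBall 0 R)ᶜ, (c + ‖x‖ ^ 2 / 2)
      ∂(μ k : Measure (EuclideanSpace ℝ (Fin n))) ≤ ε := by
  have hε' : 0 < ε / (c + 1) := by positivity
  obtain ⟨T, hT, hT1⟩ := ((tendsto_integral_min_norm_sq (n := n)).eventually
    (lt_mem_nhds (sub_lt_self (n : ℝ) hε')) |>.and (eventually_ge_atTop 1)).exists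
  have hT1' : (1 : ℝ) ≤ T := by exact_mod_cast hT1
  refine ⟨√(2 * T), ?_⟩
  filter_upwards [(tendsto_integral_min_norm_sq_of_tendsto hμ (Nat.cast_nonneg T)).eventually
    (lt_mem_nhds hT)] with k hk
  have hint1 := (hiso k).integrable_norm_sq
  have hint2 := integrable_min_norm_sq (μ k : Measure (EuclideanSpace ℝ (Fin n)))
    (Nat.cast_nonneg T)
  have hint := (hint1.sub hint2).const_mul (c + 1)
  calc ∫ x in (Metric.closedBall 0 √(2 * T))ᶜ, (c + ‖x‖ ^ 2 / 2)
        ∂(μ k : Measure (EuclideanSpace ℝ (Fin n)))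
      ≤ ∫ x in (Metric.closedBall 0 √(2 * T))ᶜ, (c + 1) * (‖x‖ ^ 2 - min (‖x‖ ^ 2) T)
        ∂(μ k : Measure (EuclideanSpace ℝ (Fin n))) := by
        refine setIntegral_mono_on ((integrable_const c).add (hint1.div_const 2)).integrableOn
          hint.integrableOn Metric.isClosed_closedBall.measurableSet.compl fun x hx => ?_
        have hx' : 2 * (T : ℝ) < ‖x‖ ^ 2 := by
          rw [Set.mem_compl_iff, mem_closedBall_zero_iff, not_le] at hx
          exact (Real.sqrt_lt' ((Real.sqrt_nonneg _).trans_lt hx)).1 hx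
        -- On this set `‖x‖ ^ 2 - T ≥ ‖x‖ ^ 2 / 2 ≥ T ≥ 1`.
        rw [min_eq_right (by linarith)]
        nlinarith
    _ ≤ ∫ x, (c + 1) * (‖x‖ ^ 2 - min (‖x‖ ^ 2) T)
        ∂(μ k : Measure (EuclideanSpace ℝ (Fin n))) := by
        refine setIntegral_le_integral hint (Eventually.of_forall fun x => ?_)
        exact mul_nonneg (by linarith) (sub_nonneg.2 (min_le_left _ _))
    _ ≤ (c + 1) * (ε / (c + 1)) := by
        rw [integral_const_mul, integral_sub hint1 hint2, (hiso k).integral_norm_sq]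
        gcongr
        linarith
    _ = ε := by field_simp

end Tail

section Convergence

open Metric

variable {n : ℕ} {μ : ℕ → ProbabilityMeasure (EuclideanSpace ℝ (Fin n))}

lemma eventually_rnDeriv_le_on_closedBall
    (hlc : ∀ k, IsLogConcaveMeasure (μ k : Measure (EuclideanSpace ℝ (Fin n))))
    (hac : ∀ᶠ k in atTop, (μ k : Measure (EuclideanSpace ℝ (Fin n))) ≪
      stdGaussian (EuclideanSpace ℝ (Fin n)))
    (hμ : Tendsto μ atTop (𝓝 (standardGaussian n))) {b : ℝ} (hb : 1 < b) (R : ℝ) :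
    ∀ᶠ k in atTop, ∀ᵐ x ∂stdGaussian (EuclideanSpace ℝ (Fin n)), x ∈ closedBall 0 R →
      (μ k : Measure (EuclideanSpace ℝ (Fin n))).rnDeriv (stdGaussian (EuclideanSpace ℝ (Fin n))) x
        ≤ ENNReal.ofReal (b ^ 4) := by
  choose ρ hρ hev using fun x₀ => eventually_measure_le_mul_stdGaussian_near hlc hμ x₀ hb
  obtain ⟨t, ht⟩ := (isCompact_closedBall (0 : EuclideanSpace ℝ (Fin n)) R).elim_nhds_subcover
    (fun x => ball x (ρ x)) fun x _ => ball_mem_nhds x (hρ x)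
  filter_upwards [(eventually_all_finset t).2 fun x _ => hev x, hac] with k hk hack
  have hae : ∀ᵐ x ∂stdGaussian (EuclideanSpace ℝ (Fin n)), ∀ y ∈ t, x ∈ ball y (ρ y) →
      (μ k : Measure (EuclideanSpace ℝ (Fin n))).rnDeriv (stdGaussian (EuclideanSpace ℝ (Fin n))) x
        ≤ ENNReal.ofReal (b ^ 4) := by
    refine (eventually_all_finset t).2 fun y hy => ?_
    refine rnDeriv_le_of_forall_measure_le hack measurableSet_ball fun s hs hsm => ?_
    rw [setLIntegral_const]
    exact hk y hy s hs hsm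
  filter_upwards [hae] with x hx hxR
  obtain ⟨y, hy, hxy⟩ := Set.mem_iUnion₂.1 (ht.2 hxR)
  exact hx y hy hxy

/-- A multiple of Lebesgue measure has a density with respect to the Gaussian measure, which is of
the form `exp (c + ‖x‖ ^ 2 / 2)`; the constant `c` may be enlarged to be nonnegative. -/
lemma exists_mul_volume_le_lintegral_exp (n : ℕ) {C : ℝ} (hC : 0 < C) :
    ∃ c : ℝ, 0 ≤ c ∧ ∀ s : Set (EuclideanSpace ℝ (Fin n)), MeasurableSet s →
      ENNReal.ofReal C * volume s ≤ ∫⁻ x in s, ENNReal.ofReal (Real.exp (c + ‖x‖ ^ 2 / 2))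
        ∂stdGaussian (EuclideanSpace ℝ (Fin n)) := by
  set Z : ℝ := (2 * Real.pi) ^ (-(n / 2 : ℝ))
  have hZ : 0 < Z := by positivity
  refine ⟨max 0 (Real.log (C / Z)), le_max_left _ _, fun s hs => ?_⟩
  rw [stdGaussian_eq_withDensity, setLIntegral_withDensity_eq_setLIntegral_mul _
    (by have := continuous_gaussianDensity n; fun_prop) (by fun_prop) hs, ← setLIntegral_const]
  refine setLIntegral_mono' hs fun x _ => ?_
  rw [Pi.mul_apply, ← ENNReal.ofReal_mul (gaussianDensity_pos x).le]
  refine ENNReal.ofReal_le_ofReal ?_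
  rw [gaussianDensity, mul_assoc, ← Real.exp_add]
  calc C = Z * Real.exp (Real.log (C / Z)) := by
        rw [Real.exp_log (by positivity)]; field_simp
    _ ≤ _ := by
        gcongr
        linarith [le_max_right 0 (Real.log (C / Z))]

theorem tendsto_klDiv_of_tendsto
    (hlc : ∀ k, IsLogConcaveMeasure (μ k : Measure (EuclideanSpace ℝ (Fin n))))
    (hiso : ∀ k, IsIsotropicMeasure (μ k : Measure (EuclideanSpace ℝ (Fin n))))
    (hμ : Tendsto μ atTop (𝓝 (standardGaussian n))) :
    Tendsto (fun k => InformationTheory.klDiv (μ k : Measure (EuclideanSpace ℝ (Fin n)))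
      (stdGaussian (EuclideanSpace ℝ (Fin n)))) atTop (𝓝 0) := by
  obtain ⟨C, hC, hvol⟩ := eventually_measure_le_mul_volume hlc hμ
  obtain ⟨c, hc, hexp⟩ := exists_mul_volume_le_lintegral_exp n hC
  have hac : ∀ᶠ k in atTop, (μ k : Measure (EuclideanSpace ℝ (Fin n))) ≪
      stdGaussian (EuclideanSpace ℝ (Fin n)) := by
    filter_upwards [hvol] with k hk
    refine Measure.AbsolutelyContinuous.trans (fun s hs => ?_) (absolutelyContinuous_stdGaussian n)
    simpa [hs] using hk s
  have hkey (ε : ℝ) (hε : 0 < ε) : ∀ᶠ k in atTop,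
      InformationTheory.klDiv (μ k : Measure (EuclideanSpace ℝ (Fin n)))
        (stdGaussian (EuclideanSpace ℝ (Fin n))) ≤ ENNReal.ofReal (4 * ε + ε) := by
    obtain ⟨R, hR⟩ := exists_eventually_setIntegral_compl_closedBall_le hiso hμ hc hε
    have hb : 1 < Real.exp ε := Real.one_lt_exp_iff.2 hε
    filter_upwards [hvol, hac, hR, eventually_rnDeriv_le_on_closedBall hlc hac hμ hb R] with
      k hk hack hRk hloc
    have hB : MeasurableSet (closedBall (0 : EuclideanSpace ℝ (Fin n)) R) :=
      measurableSet_closedBall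
    have hint : Integrable (fun x => c + ‖x‖ ^ 2 / 2)
        (μ k : Measure (EuclideanSpace ℝ (Fin n))) :=
      (integrable_const c).add ((hiso k).integrable_norm_sq.div_const 2)
    have hg1 := (integrable_const (μ := (μ k : Measure (EuclideanSpace ℝ (Fin n))))
      (4 * ε)).indicator hB
    have hg2 := hint.indicator hB.compl
    -- The logarithm of the density is at most `4ε` on the ball and `c + ‖x‖ ^ 2 / 2` off it.
    refine (klDiv_le_ofReal_integral hack (hg1.add hg2) ?_).trans (ENNReal.ofReal_le_ofReal ?_)
    · have hglob := rnDeriv_le_of_forall_measure_le hack MeasurableSet.univ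
        fun s _ hs => (hk s).trans (hexp s hs)
      filter_upwards [hloc, hglob] with x hx1 hx2
      by_cases hxB : x ∈ closedBall 0 R
      · have h4 : Real.exp (4 * ε) = Real.exp ε ^ 4 := by rw [← Real.exp_nat_mul]; norm_num
        simpa [hxB, h4] using hx1 hxB
      · simpa [Set.indicator, hxB] using hx2 (Set.mem_univ x)
    · simp only [Pi.add_apply]
      rw [integral_add hg1 hg2, integral_indicator hB, integral_indicator hB.compl]
      refine add_le_add ?_ hRk
      rw [setIntegral_const, smul_eq_mul]
      exact mul_le_of_le_one_left (by positivity) measureReal_le_one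
  rw [ENNReal.tendsto_nhds_zero]
  intro a ha
  obtain ⟨ε, hε, hεa⟩ : ∃ ε : ℝ, 0 < ε ∧ ENNReal.ofReal (4 * ε + ε) ≤ a := by
    by_cases hat : a = ∞
    · exact ⟨1, one_pos, by simp [hat]⟩
    · refine ⟨a.toReal / 5, by have := ENNReal.toReal_pos ha.ne' hat; positivity, ?_⟩
      rw [show 4 * (a.toReal / 5) + a.toReal / 5 = a.toReal by ring, ENNReal.ofReal_toReal hat]
  exact (hkey ε hε).mono fun k hk => hk.trans hεa

end Convergence

theorem corollaryT (n : ℕ) (μ : ℕ → ProbabilityMeasure (EuclideanSpace ℝ (Fin n)))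
    (hlc : ∀ k, IsLogConcaveMeasure (μ k : Measure (EuclideanSpace ℝ (Fin n))))
    (hiso : ∀ k, IsIsotropicMeasure (μ k : Measure (EuclideanSpace ℝ (Fin n)))) :
    List.TFAE [
      Tendsto μ atTop (𝓝 (standardGaussian n)),
      Tendsto (fun k => tvDistance (μ k) (standardGaussian n)) atTop (𝓝 0),
      Tendsto (fun k => InformationTheory.klDiv
        (μ k : Measure (EuclideanSpace ℝ (Fin n)))
        (standardGaussian n : Measure (EuclideanSpace ℝ (Fin n)))) atTop (𝓝 0)] := by
  tfae_have 1 → 3 := tendsto_klDiv_of_tendsto hlc hiso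
  tfae_have 3 → 2 := tendsto_tvDistance_of_tendsto_klDiv
  tfae_have 2 → 1 := tendsto_of_tendsto_tvDistance
  tfae_finish
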